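/- Let $(M,g)$ be a smooth Riemannian manifold (without boundary) of dimension $n\ge 3$. For $x\in M$ and a plane $\pi\subset T_xM$ spanned by linearly independent vectors $u,v$, let $$k(\pi)=\frac{R(u,v,u,v)}{g(u,u)g(v,v)-g(u,v)^2}$$ be its sectional curvature, where $R$ is the Riemann curvature tensor of the Levi-Civita connection, with the sign for which round spheres have positive sectional curvature. Let $$\tau(x)=\sum_{1\le i<j\le n}R(e_i,e_j,e_i,e_j)$$ be the scalar curvature at $x$, where $e_1,\dots,e_n$ is an orthonormal basis of $T_xM$. Suppose that $(M,g)$ admits a minimal isometric immersion into a Euclidean space, that is, for some $m\ge 0$ there is a smooth map $f:M\to\mathbb R^m$ with $\langle df_x(u),df_x(v)\rangle=g(u,v)$ for all $x\in M$ and $u,v\in T_xM$, whose mean curvature vector $H=\frac1n\sum_{i=1}^n h(e_i,e_i)$ vanishes identically, $h$ being the second fundamental form of $f$. Then, for every $x\in M$ and every plane $\pi\subset T_xM$, $$\tau(x)\le k(\pi)\le-\tau(x).$$ -/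

import Mathlib

open Bundle
open scoped Manifold ContDiff

noncomputable section

namespace MinimalImmersion

/-- The standard model `ℝⁿ` of an `n`-dimensional manifold, with its Euclidean norm. -/
abbrev Model (n : ℕ) : Type := EuclideanSpace ℝ (Fin n)

section Curvature

variable {n : ℕ} {M : Type*} [TopologicalSpace M] [ChartedSpace (Model n) M]

/-- The `i`-th coordinate vector field `∂ᵢ` of the preferred chart `φ` around `x`, at the point of
`M` with coordinates `y`, namely `d(φ⁻¹)_y` applied to the `i`-th standard basis vector. -/
def coordField (x : M) (i : Fin n) (y : Model n) :
    TangentSpace (𝓡 n) ((extChartAt (𝓡 n) x).symm y) :=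
  mfderiv 𝓘(ℝ, Model n) (𝓡 n) (extChartAt (𝓡 n) x).symm y (EuclideanSpace.single i (1 : ℝ))

/-- The coordinates `uⁱ` of a tangent vector `u = ∑ uⁱ ∂ᵢ` at `x`, in the preferred chart
around `x`. -/
def coord (x : M) (u : TangentSpace (𝓡 n) x) : Model n :=
  mfderiv (𝓡 n) 𝓘(ℝ, Model n) (extChartAt (𝓡 n) x) x u

/-- The partial derivative `∂ᵢ a` at `y` of a function on coordinate space. -/
def partialDeriv (i : Fin n) (a : Model n → ℝ) (y : Model n) : ℝ :=
  fderiv ℝ a y (EuclideanSpace.single i (1 : ℝ))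

variable [RiemannianBundle (fun x : M ↦ TangentSpace (𝓡 n) x)]

/-- The matrix `g_{ij}(y) = g(∂ᵢ, ∂ⱼ)` of the Riemannian metric in the preferred chart
around `x`. -/
def gramMatrix (x : M) (y : Model n) : Matrix (Fin n) (Fin n) ℝ :=
  Matrix.of fun i j ↦ inner ℝ (coordField x i y) (coordField x j y)

/-- The Christoffel symbols `Γˡ_{ij} = ½ ∑ₚ g^{lp} (∂ᵢ g_{jp} + ∂ⱼ g_{ip} - ∂ₚ g_{ij})` of the
Levi-Civita connection in the preferred chart around `x`, so that `∇_{∂ᵢ} ∂ⱼ = ∑ₗ Γˡ_{ij} ∂ₗ`. -/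
def christoffel (x : M) (l i j : Fin n) (y : Model n) : ℝ :=
  (1 / 2 : ℝ) * ∑ p, (gramMatrix x y)⁻¹ l p *
    (partialDeriv i (fun z ↦ gramMatrix x z j p) y
      + partialDeriv j (fun z ↦ gramMatrix x z i p) y
      - partialDeriv p (fun z ↦ gramMatrix x z i j) y)

/-- The components `Rˡ_{ijk}` of the curvature tensor
`R(X, Y) Z = ∇_X ∇_Y Z - ∇_Y ∇_X Z - ∇_{[X, Y]} Z` of the Levi-Civita connection, so that
`R(∂ᵢ, ∂ⱼ) ∂ₖ = ∑ₗ Rˡ_{ijk} ∂ₗ`, in the preferred chart around `x`. -/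
def curvatureComponent (x : M) (l i j k : Fin n) (y : Model n) : ℝ :=
  partialDeriv i (christoffel x l j k) y - partialDeriv j (christoffel x l i k) y
    + ∑ p, (christoffel x p j k y * christoffel x l i p y
      - christoffel x p i k y * christoffel x l j p y)

/-- The Riemann curvature tensor `R(u, v, w, z) = g(R(u, v) z, w)` at `x`; the order of the
arguments is such that `R(u, v, u, v)` is positive on round spheres. -/
def riemannTensor (x : M) (u v w z : TangentSpace (𝓡 n) x) : ℝ :=
  ∑ i, ∑ j, ∑ k, ∑ l, ∑ p,
    gramMatrix x (extChartAt (𝓡 n) x x) l p *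
      curvatureComponent x l i j k (extChartAt (𝓡 n) x x) *
      coord x u i * coord x v j * coord x z k * coord x w p

/-- The sectional curvature `k(u ∧ v)` of the plane spanned by two linearly independent tangent
vectors `u`, `v` at `x`. -/
def sectionalCurvature (x : M) (u v : TangentSpace (𝓡 n) x) : ℝ :=
  riemannTensor x u v u v / (inner ℝ u u * inner ℝ v v - inner ℝ u v ^ 2)

/-- An orthonormal frame `e₁, …, eₙ` of the tangent space `T_x M`. -/
def frame (x : M) : OrthonormalBasis (Fin n) ℝ (TangentSpace (𝓡 n) x) :=
  haveI : FiniteDimensional ℝ (TangentSpace (𝓡 n) x) :=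
    inferInstanceAs (FiniteDimensional ℝ (Model n))
  (stdOrthonormalBasis ℝ (TangentSpace (𝓡 n) x)).reindex
    (finCongr (finrank_euclideanSpace_fin (𝕜 := ℝ) (n := n)))

variable (n) in
/-- The scalar curvature `τ(x) = ∑_{i < j} R(eᵢ, eⱼ, eᵢ, eⱼ)` for an orthonormal frame
`e₁, …, eₙ` of `T_x M` (each plane `eᵢ ∧ eⱼ` is counted once). -/
def scalarCurvature (x : M) : ℝ :=
  ∑ i : Fin n, ∑ j ∈ Finset.Ioi i, riemannTensor x (frame x i) (frame x j) (frame x i) (frame x j)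

end Curvature

section Immersion

variable (n : ℕ) {m : ℕ} {M : Type*} [TopologicalSpace M] [ChartedSpace (Model n) M]

/-- The differential `df_x : T_x M → ℝᵐ` of a map to a Euclidean space. -/
def differential (f : M → Model m) (x : M) : TangentSpace (𝓡 n) x →L[ℝ] Model m :=
  mvfderiv (𝓡 n) f x

/-- The second fundamental form `h(u, v) ∈ T_x^⊥ M` of an immersion `f` into a Euclidean space:
the component orthogonal to `df_x (T_x M)` of the derivative in direction `u` of `df(V)`,
for any local extension `V` of `v`. Choosing for `V` the field with constant coordinates in the
chart `φ` around `x`, that derivative is the second derivative of `f ∘ φ⁻¹`. -/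
def secondFundamentalForm (f : M → Model m) (x : M) (u v : TangentSpace (𝓡 n) x) : Model m :=
  (LinearMap.range (differential n f x).toLinearMap)ᗮ.starProjection
    (fderiv ℝ (fderiv ℝ (f ∘ (extChartAt (𝓡 n) x).symm)) (extChartAt (𝓡 n) x x)
      (coord x u) (coord x v))

variable [RiemannianBundle (fun x : M ↦ TangentSpace (𝓡 n) x)]

/-- A smooth isometric immersion into a Euclidean space: a smooth map whose differentials preserve
the inner products (so that they are injective). -/
structure IsIsometricImmersion (f : M → Model m) : Prop where
  contMDiff : ContMDiff (𝓡 n) 𝓘(ℝ, Model m) ∞ f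
  inner_differential : ∀ (x : M) (u v : TangentSpace (𝓡 n) x),
    inner ℝ (differential n f x u) (differential n f x v) = inner ℝ u v

/-- The mean curvature vector `H = (1/n) ∑ᵢ h(eᵢ, eᵢ)`, for an orthonormal frame of `T_x M`. -/
def meanCurvature (f : M → Model m) (x : M) : Model m :=
  (n : ℝ)⁻¹ • ∑ i, secondFundamentalForm n f x (frame x i) (frame x i)

/-- A minimal isometric immersion: the mean curvature vector vanishes identically. -/
structure IsMinimalIsometricImmersion (f : M → Model m) : Prop
    extends IsIsometricImmersion n f where
  meanCurvature_eq_zero : ∀ x, meanCurvature n f x = 0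

end Immersion

end MinimalImmersion

end

/-! By the Gauss equation, R(u,v,u,v) = ⟪h(u,u), h(v,v)⟫ - ‖h(u,v)‖². Let S be the sum of
‖h(eᵢ,eⱼ)‖² over all i, j. Summing over ordered pairs gives 2τ = ‖∑ h(eᵢ,eᵢ)‖² - S, so minimality
forces τ = -S/2 (`scalarCurvature_eq_neg_half_sum`). The claim is thus |k(π)| ≤ S/2. For an
orthonormal basis e, w of π, Cauchy–Schwarz and AM-GM bound |k(π)| by half of ‖h(e,e)‖² + ‖h(w,w)‖²
+ 2‖h(e,w)‖², and Bessel's inequality bounds that sum by S (`norm_sq_add_norm_sq_add_norm_sq_le`).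

The Gauss equation itself (`gauss_equation_inducedChristoffel`) is proved for F = f ∘ φ⁻¹ in a chart
φ. The Christoffel symbols are the tangential coefficients of ∂ᵢ∂ⱼF, and third derivatives of F
cancel in the curvature. -/

namespace MinimalImmersion

open Filter Topology
open scoped RealInnerProductSpace

noncomputable section

/-! ### Partial derivatives on coordinate space -/

section Calculus

variable {n : ℕ} {E : Type*} [NormedAddCommGroup E] [InnerProductSpace ℝ E]

/-- The partial derivative of a vector-valued function on coordinate space. -/
def vecPartial (i : Fin n) (a : Model n → E) (y : Model n) : E :=
  fderiv ℝ a y (EuclideanSpace.single i (1 : ℝ))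

theorem contDiffAt_vecPartial {a : Model n → E} {y : Model n} (ha : ContDiffAt ℝ ∞ a y)
    (i : Fin n) : ContDiffAt ℝ ∞ (vecPartial i a) y := by
  have h : ContDiffAt ℝ ∞ (fderiv ℝ a) y := ha.fderiv_right (by simp)
  exact h.clm_apply contDiffAt_const

theorem vecPartial_vecPartial {a : Model n → E} {y : Model n} (ha : ContDiffAt ℝ ∞ a y)
    (i j : Fin n) :
    vecPartial i (vecPartial j a) y =
      fderiv ℝ (fderiv ℝ a) y (EuclideanSpace.single i 1) (EuclideanSpace.single j 1) := by
  have h : DifferentiableAt ℝ (fderiv ℝ a) y :=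
    (ha.fderiv_right (m := ∞) (by simp)).differentiableAt (by simp)
  unfold vecPartial
  rw [fderiv_clm_apply h (differentiableAt_const _)]
  simp

theorem vecPartial_comm {a : Model n → E} {y : Model n} (ha : ContDiffAt ℝ ∞ a y)
    (i j : Fin n) :
    vecPartial i (vecPartial j a) y = vecPartial j (vecPartial i a) y := by
  rw [vecPartial_vecPartial ha, vecPartial_vecPartial ha]
  refine ha.isSymmSndFDerivAt ?_ _ _
  -- Over ℝ, symmetry of the second derivative only needs class C².
  rw [minSmoothness_of_isRCLikeNormedField]
  exact WithTop.coe_le_coe.2 le_top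

theorem vecPartial_congr {a b : Model n → E} {y : Model n} (h : a =ᶠ[𝓝 y] b) (i : Fin n) :
    vecPartial i a y = vecPartial i b y := by
  rw [vecPartial, vecPartial, h.fderiv_eq]

theorem partialDeriv_congr {a b : Model n → ℝ} {y : Model n} (h : a =ᶠ[𝓝 y] b) (i : Fin n) :
    partialDeriv i a y = partialDeriv i b y :=
  vecPartial_congr h i

theorem partialDeriv_inner {a b : Model n → E} {y : Model n} (ha : DifferentiableAt ℝ a y)
    (hb : DifferentiableAt ℝ b y) (i : Fin n) :
    partialDeriv i (fun z ↦ ⟪a z, b z⟫) y = ⟪vecPartial i a y, b y⟫ + ⟪a y, vecPartial i b y⟫ := by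
  rw [partialDeriv, fderiv_inner_apply ℝ ha hb, add_comm]
  rfl

theorem partialDeriv_mul {a b : Model n → ℝ} {y : Model n} (ha : DifferentiableAt ℝ a y)
    (hb : DifferentiableAt ℝ b y) (i : Fin n) :
    partialDeriv i (fun z ↦ a z * b z) y = partialDeriv i a y * b y + a y * partialDeriv i b y := by
  rw [partialDeriv, fderiv_fun_mul ha hb]
  simp [partialDeriv]
  ring

theorem partialDeriv_sum {ι : Type*} (s : Finset ι) {a : ι → Model n → ℝ} {y : Model n}
    (ha : ∀ l ∈ s, DifferentiableAt ℝ (a l) y) (i : Fin n) :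
    partialDeriv i (fun z ↦ ∑ l ∈ s, a l z) y = ∑ l ∈ s, partialDeriv i (a l) y := by
  rw [partialDeriv, fderiv_fun_sum ha]
  simp [partialDeriv]

end Calculus

/-! ### Differentiability of the inverse matrix -/

section MatrixInverse

variable {X : Type*} [NormedAddCommGroup X] [NormedSpace ℝ X] {ι : Type*} [Fintype ι]
  [DecidableEq ι]

theorem differentiableAt_det {A : X → Matrix ι ι ℝ} {y : X}
    (hA : ∀ i j, DifferentiableAt ℝ (fun z ↦ A z i j) y) :
    DifferentiableAt ℝ (fun z ↦ (A z).det) y := by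
  simp only [Matrix.det_apply]
  refine DifferentiableAt.fun_sum fun σ _ ↦ ?_
  refine DifferentiableAt.fun_const_smul ?_ _
  exact (HasFDerivAt.finsetProd fun i _ ↦ (hA (σ i) i).hasFDerivAt).differentiableAt

theorem differentiableAt_matrix_inv {A : X → Matrix ι ι ℝ} {y : X}
    (hA : ∀ i j, DifferentiableAt ℝ (fun z ↦ A z i j) y) (hdet : (A y).det ≠ 0) (i j : ι) :
    DifferentiableAt ℝ (fun z ↦ (A z)⁻¹ i j) y := by
  simp only [Matrix.inv_def, Ring.inverse_eq_inv', Matrix.smul_apply, smul_eq_mul,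
    Matrix.adjugate_apply]
  refine ((differentiableAt_det hA).fun_inv hdet).mul (differentiableAt_det fun k l ↦ ?_)
  -- By Cramer's rule, an adjugate entry is the determinant of `A` with row `j` made constant; the
  -- other rows are unchanged.
  by_cases h : k = j
  · subst h
    simp
  · simpa [Matrix.updateRow_ne h] using hA k l

end MatrixInverse

/-! ### The Gauss equation in coordinates -/

section Gauss

variable {n : ℕ} {E : Type*} [NormedAddCommGroup E] [InnerProductSpace ℝ E]

/-- The Christoffel symbols of the metric induced by `F`, `G` being its Gram matrix. -/
def inducedChristoffel (F : Model n → E) (G : Model n → Matrix (Fin n) (Fin n) ℝ)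
    (l i j : Fin n) (y : Model n) : ℝ :=
  ∑ p, (G y)⁻¹ l p * ⟪vecPartial i (vecPartial j F) y, vecPartial p F y⟫

variable {F : Model n → E} {G : Model n → Matrix (Fin n) (Fin n) ℝ} {S : Set (Model n)}
  {y : Model n}

/-- Lowering the upper index cancels `G⁻¹`. Later arguments use this form, so that no derivative of
`G⁻¹` has to be computed. -/
theorem sum_gram_mul_inducedChristoffel
    (hG : ∀ i j, G y i j = ⟪vecPartial i F y, vecPartial j F y⟫) (hdet : (G y).det ≠ 0)
    (i j p : Fin n) :
    ∑ l, G y l p * inducedChristoffel F G l i j y =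
      ⟪vecPartial i (vecPartial j F) y, vecPartial p F y⟫ := by
  have hsymm : ∀ l, G y l p = G y p l := fun l ↦ by rw [hG, hG, real_inner_comm]
  simp only [hsymm]
  have h := Matrix.mulVec_mulVec
    (fun p ↦ ⟪vecPartial i (vecPartial j F) y, vecPartial p F y⟫) (G y) (G y)⁻¹
  rw [Matrix.mul_nonsing_inv _ (isUnit_iff_ne_zero.2 hdet), Matrix.one_mulVec] at h
  exact congrFun h p

theorem differentiableAt_inducedChristoffel (hF : ContDiffAt ℝ ∞ F y)
    (hG : ∀ᶠ z in 𝓝 y, ∀ i j, G z i j = ⟪vecPartial i F z, vecPartial j F z⟫)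
    (hdet : (G y).det ≠ 0) (l i j : Fin n) :
    DifferentiableAt ℝ (inducedChristoffel F G l i j) y := by
  have hD : ∀ p, DifferentiableAt ℝ (vecPartial p F) y := fun p ↦
    (contDiffAt_vecPartial hF p).differentiableAt (by simp)
  refine DifferentiableAt.fun_sum fun p _ ↦ DifferentiableAt.fun_mul
    (differentiableAt_matrix_inv (fun i j ↦ ?_) hdet l p) (DifferentiableAt.inner ℝ ?_ (hD p))
  · exact ((hD i).inner ℝ (hD j)).congr_of_eventuallyEq (hG.mono fun z hz ↦ hz i j)
  · exact (contDiffAt_vecPartial (contDiffAt_vecPartial hF j) i).differentiableAt (by simp)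

/-- The component of `∂ᵢ ∂ⱼ F` orthogonal to the image of the differential. -/
theorem starProjection_orthogonal_vecPartial [FiniteDimensional ℝ E]
    (hG : ∀ i j, G y i j = ⟪vecPartial i F y, vecPartial j F y⟫) (hdet : (G y).det ≠ 0)
    (i j : Fin n) :
    (Submodule.span ℝ (Set.range fun l ↦ vecPartial l F y))ᗮ.starProjection
        (vecPartial i (vecPartial j F) y) =
      vecPartial i (vecPartial j F) y - ∑ l, inducedChristoffel F G l i j y • vecPartial l F y := by
  -- The candidate must be orthogonal to every ∂ₚF, and must differ from ∂ᵢ∂ⱼF by a tangential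
  -- vector.
  refine Submodule.eq_starProjection_of_mem_orthogonal ?_ ?_
  · rw [Submodule.mem_orthogonal]
    intro w hw
    induction hw using Submodule.span_induction with
    | mem w hw =>
      obtain ⟨p, rfl⟩ := hw
      simp only [inner_sub_right, inner_sum, inner_smul_right]
      rw [real_inner_comm, ← sum_gram_mul_inducedChristoffel hG hdet i j p, sub_eq_zero]
      refine Finset.sum_congr rfl fun l _ ↦ ?_
      rw [hG, real_inner_comm, mul_comm]
    | zero => simp
    | add a b _ _ ha hb => rw [inner_add_left, ha, hb, add_zero]
    | smul c a _ ha => rw [inner_smul_left, ha, mul_zero]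
  · rw [sub_sub_cancel, Submodule.orthogonal_orthogonal]
    exact Submodule.sum_mem _ fun l _ ↦ Submodule.smul_mem _ _
      (Submodule.subset_span (Set.mem_range_self l))

/-- Comes from differentiating `sum_gram_mul_inducedChristoffel`, valid near `y`, by the product
rule and solving for the term with the derivative of the symbols. -/
theorem sum_gram_mul_partialDeriv_inducedChristoffel (hF : ContDiffAt ℝ ∞ F y)
    (hG : ∀ᶠ z in 𝓝 y, ∀ i j, G z i j = ⟪vecPartial i F z, vecPartial j F z⟫)
    (hdet : ∀ᶠ z in 𝓝 y, (G z).det ≠ 0) (i j k p : Fin n) :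
    ∑ l, G y l p * partialDeriv i (inducedChristoffel F G l j k) y =
      ⟪vecPartial i (vecPartial j (vecPartial k F)) y, vecPartial p F y⟫
      + ⟪vecPartial j (vecPartial k F) y, vecPartial i (vecPartial p F) y⟫
      - ∑ l, (⟪vecPartial i (vecPartial l F) y, vecPartial p F y⟫
        + ⟪vecPartial l F y, vecPartial i (vecPartial p F) y⟫)
          * inducedChristoffel F G l j k y := by
  have hD : ∀ p, DifferentiableAt ℝ (vecPartial p F) y := fun p ↦
    (contDiffAt_vecPartial hF p).differentiableAt (by simp)
  have hDD : DifferentiableAt ℝ (vecPartial j (vecPartial k F)) y :=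
    (contDiffAt_vecPartial (contDiffAt_vecPartial hF k) j).differentiableAt (by simp)
  have hGeq : ∀ l, (fun z ↦ G z l p) =ᶠ[𝓝 y] fun z ↦ ⟪vecPartial l F z, vecPartial p F z⟫ :=
    fun l ↦ hG.mono fun z hz ↦ hz l p
  have hGd : ∀ l, DifferentiableAt ℝ (fun z ↦ G z l p) y := fun l ↦
    ((hD l).inner ℝ (hD p)).congr_of_eventuallyEq (hGeq l)
  have hC := fun l ↦ differentiableAt_inducedChristoffel hF hG hdet.self_of_nhds l j k
  have key : partialDeriv i (fun z ↦ ∑ l, G z l p * inducedChristoffel F G l j k z) y =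
      partialDeriv i (fun z ↦ ⟪vecPartial j (vecPartial k F) z, vecPartial p F z⟫) y :=
    partialDeriv_congr ((hG.and hdet).mono fun z hz ↦
      sum_gram_mul_inducedChristoffel hz.1 hz.2 j k p) i
  rw [partialDeriv_inner hDD (hD p), partialDeriv_sum _ fun l _ ↦ (hGd l).fun_mul (hC l)] at key
  rw [← key, ← Finset.sum_sub_distrib]
  refine Finset.sum_congr rfl fun l _ ↦ ?_
  rw [partialDeriv_mul (hGd l) (hC l), partialDeriv_congr (hGeq l), partialDeriv_inner (hD l) (hD p)]
  ring

/-- The **Gauss equation** in local coordinates. -/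
theorem gauss_equation_inducedChristoffel [FiniteDimensional ℝ E] (hF : ContDiffAt ℝ ∞ F y)
    (hG : ∀ᶠ z in 𝓝 y, ∀ i j, G z i j = ⟪vecPartial i F z, vecPartial j F z⟫)
    (hdet : ∀ᶠ z in 𝓝 y, (G z).det ≠ 0) {K : Submodule ℝ E}
    (hK : K = Submodule.span ℝ (Set.range fun l ↦ vecPartial l F y)) (i j k p : Fin n) :
    ∑ l, G y l p * (partialDeriv i (inducedChristoffel F G l j k) y
        - partialDeriv j (inducedChristoffel F G l i k) y
        + ∑ q, (inducedChristoffel F G q j k y * inducedChristoffel F G l i q y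
          - inducedChristoffel F G q i k y * inducedChristoffel F G l j q y)) =
      ⟪Kᗮ.starProjection (vecPartial j (vecPartial k F) y),
        Kᗮ.starProjection (vecPartial i (vecPartial p F) y)⟫
      - ⟪Kᗮ.starProjection (vecPartial i (vecPartial k F) y),
        Kᗮ.starProjection (vecPartial j (vecPartial p F) y)⟫ := by
  have hGy := hG.self_of_nhds
  have hdety := hdet.self_of_nhds
  -- The projection is self-adjoint and idempotent, so one of the two copies can be dropped.
  have hproj : ∀ a b : E, ⟪Kᗮ.starProjection a, Kᗮ.starProjection b⟫ =
      ⟪Kᗮ.starProjection a, b⟫ := fun a b ↦ by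
    rw [← Submodule.inner_starProjection_left_eq_right,
      Submodule.starProjection_eq_self_iff.2 (Submodule.starProjection_apply_mem _ _)]
  rw [hproj, hproj, hK, starProjection_orthogonal_vecPartial hGy hdety,
    starProjection_orthogonal_vecPartial hGy hdety]
  have hA := sum_gram_mul_partialDeriv_inducedChristoffel hF hG hdet
  have hB : ∀ i j k, ∑ l, G y l p * ∑ q, inducedChristoffel F G q j k y *
      inducedChristoffel F G l i q y = ∑ q, ⟪vecPartial i (vecPartial q F) y, vecPartial p F y⟫ *
        inducedChristoffel F G q j k y := fun i j k ↦ by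
    simp only [Finset.mul_sum]
    rw [Finset.sum_comm]
    refine Finset.sum_congr rfl fun q _ ↦ ?_
    rw [← sum_gram_mul_inducedChristoffel hGy hdety i q p, Finset.sum_mul]
    exact Finset.sum_congr rfl fun l _ ↦ by ring
  -- The third derivatives are symmetric in `i`, `j` and drop out of the antisymmetrised expression.
  have hcomm : vecPartial i (vecPartial j (vecPartial k F)) y =
      vecPartial j (vecPartial i (vecPartial k F)) y :=
    vecPartial_comm (contDiffAt_vecPartial hF k) i j
  simp only [mul_add, mul_sub, Finset.sum_add_distrib, Finset.sum_sub_distrib, hA, hB, hcomm,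
    add_mul, inner_sub_left, sum_inner, real_inner_smul_left]
  simp only [mul_comm (inducedChristoffel F G _ _ _ _)]
  ring

end Gauss

/-! ### Curvature bounds for symmetric bilinear maps -/

section LinearAlgebra

variable {V E : Type*} [NormedAddCommGroup V] [InnerProductSpace ℝ V]
  [NormedAddCommGroup E] [InnerProductSpace ℝ E]

/-- With an orthonormal basis `d` of `E`, ‖L v‖² is the sum of the ⟪v, L* dₖ⟫². For each k, Parseval
applies to `b` and Bessel to `c`. -/
theorem sum_norm_sq_apply_le_of_orthonormal [FiniteDimensional ℝ E] {ι κ : Type*} [Fintype ι]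
    [Fintype κ] (b : OrthonormalBasis ι ℝ V) {c : κ → V} (hc : Orthonormal ℝ c) (L : V →ₗ[ℝ] E) :
    ∑ i, ‖L (c i)‖ ^ 2 ≤ ∑ i, ‖L (b i)‖ ^ 2 := by
  have : FiniteDimensional ℝ V := b.toBasis.finiteDimensional_of_finite
  let d := stdOrthonormalBasis ℝ E
  have h : ∀ v, ‖L v‖ ^ 2 = ∑ k, ‖⟪v, L.adjoint (d k)⟫‖ ^ 2 := fun v ↦ by
    simp only [LinearMap.adjoint_inner_right, d.sum_sq_norm_inner_left]
  simp only [h]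
  rw [Finset.sum_comm, Finset.sum_comm (s := Finset.univ (α := ι))]
  refine Finset.sum_le_sum fun k _ ↦ ?_
  rw [b.sum_sq_norm_inner_right]
  exact hc.sum_inner_products_le _

/-- The pair `e`, `w` replaces the basis `b` in one argument of `h` at a time, each replacement only
decreasing the sum of squares. The mixed term occurs twice by symmetry. -/
theorem norm_sq_add_norm_sq_add_norm_sq_le [FiniteDimensional ℝ E] {ι : Type*} [Fintype ι]
    (b : OrthonormalBasis ι ℝ V) (h : V →ₗ[ℝ] V →ₗ[ℝ] E) (hs : ∀ u v, h u v = h v u)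
    {e w : V} (hew : Orthonormal ℝ ![e, w]) :
    ‖h e e‖ ^ 2 + ‖h w w‖ ^ 2 + 2 * ‖h e w‖ ^ 2 ≤ ∑ i, ∑ j, ‖h (b i) (b j)‖ ^ 2 := by
  have h1 := sum_norm_sq_apply_le_of_orthonormal b hew (h e)
  have h2 := sum_norm_sq_apply_le_of_orthonormal b hew (h w)
  have h3 : ∀ j, ‖h e (b j)‖ ^ 2 + ‖h w (b j)‖ ^ 2 ≤ ∑ i, ‖h (b j) (b i)‖ ^ 2 := fun j ↦ by
    have := sum_norm_sq_apply_le_of_orthonormal b hew (h (b j))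
    simp only [Fin.sum_univ_two, Matrix.cons_val_zero, Matrix.cons_val_one] at this
    rwa [hs _ e, hs _ w] at this
  have h4 := Finset.sum_le_sum fun j (_ : j ∈ Finset.univ) ↦ h3 j
  simp only [Fin.sum_univ_two, Matrix.cons_val_zero, Matrix.cons_val_one,
    Finset.sum_add_distrib] at h1 h2 h4
  rw [hs w e] at h2
  linarith

/-- The curvature `R(u, v, u, v)` which the Gauss equation assigns to a second fundamental form. -/
def gaussCurvature {V : Type*} (h : V → V → E) (u v : V) : ℝ :=
  ⟪h u u, h v v⟫ - ‖h u v‖ ^ 2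

theorem abs_gaussCurvature_le_of_orthonormal [FiniteDimensional ℝ E] {ι : Type*} [Fintype ι]
    (b : OrthonormalBasis ι ℝ V) (h : V →ₗ[ℝ] V →ₗ[ℝ] E) (hs : ∀ u v, h u v = h v u)
    {e w : V} (hew : Orthonormal ℝ ![e, w]) :
    |gaussCurvature (h · ·) e w| ≤ (∑ i, ∑ j, ‖h (b i) (b j)‖ ^ 2) / 2 := by
  have h1 := norm_sq_add_norm_sq_add_norm_sq_le b h hs hew
  have h2 := abs_le.1 (abs_real_inner_le_norm (h e e) (h w w))
  have h3 := two_mul_le_add_sq ‖h e e‖ ‖h w w‖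
  have h4 := sq_nonneg ‖h e w‖
  rw [abs_le, gaussCurvature]
  constructor <;> linarith [h2.1, h2.2]

/-- Gram–Schmidt, keeping the triangular coefficients. -/
theorem exists_orthonormal_pair {u v : V} (huv : LinearIndependent ℝ ![u, v]) :
    ∃ (e w : V) (r a c : ℝ), Orthonormal ℝ ![e, w] ∧ r ≠ 0 ∧ c ≠ 0 ∧ u = r • e ∧
      v = a • e + c • w := by
  have hu : u ≠ 0 := by simpa using huv.ne_zero 0
  have hw : v - (⟪u, v⟫ / ‖u‖ ^ 2) • u ≠ 0 := by
    intro h0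
    have := LinearIndependent.pair_iff.1 huv (-(⟪u, v⟫ / ‖u‖ ^ 2)) 1
      (by rw [← h0]; module)
    exact one_ne_zero this.2
  set w := v - (⟪u, v⟫ / ‖u‖ ^ 2) • u with hwdef
  have hu' : ‖u‖ ≠ 0 := norm_ne_zero_iff.2 hu
  have hw' : ‖w‖ ≠ 0 := norm_ne_zero_iff.2 hw
  have huw : ⟪u, w⟫ = 0 := by
    rw [hwdef, inner_sub_right, inner_smul_right, real_inner_self_eq_norm_sq]
    field_simp
    ring
  refine ⟨‖u‖⁻¹ • u, ‖w‖⁻¹ • w, ‖u‖, ⟪u, v⟫ / ‖u‖, ‖w‖, ?_, hu', hw', ?_, ?_⟩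
  · simp [orthonormal_vecCons_iff, norm_smul, hu, hw, inner_smul_left, inner_smul_right, huw]
  · rw [smul_inv_smul₀ hu']
  · rw [smul_inv_smul₀ hw', smul_smul, hwdef, ← div_eq_mul_inv, div_div, ← sq]
    module

/-- Passing from `e`, `w` to `u`, `v` multiplies both numerator and denominator by the squared
determinant r²c², so the orthonormal case suffices. -/
theorem abs_gaussCurvature_div_le [FiniteDimensional ℝ E] {ι : Type*} [Fintype ι]
    (b : OrthonormalBasis ι ℝ V) (h : V →ₗ[ℝ] V →ₗ[ℝ] E) (hs : ∀ u v, h u v = h v u)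
    {u v : V} (huv : LinearIndependent ℝ ![u, v]) :
    |gaussCurvature (h · ·) u v / (⟪u, u⟫ * ⟪v, v⟫ - ⟪u, v⟫ ^ 2)| ≤
      (∑ i, ∑ j, ‖h (b i) (b j)‖ ^ 2) / 2 := by
  obtain ⟨e, w, r, a, c, hew, hr, hc, rfl, rfl⟩ := exists_orthonormal_pair huv
  have hee : ⟪e, e⟫ = 1 := by simpa using orthonormal_iff_ite.1 hew 0 0
  have hww : ⟪w, w⟫ = 1 := by simpa using orthonormal_iff_ite.1 hew 1 1
  have he_w : ⟪e, w⟫ = 0 := by simpa using orthonormal_iff_ite.1 hew 0 1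
  have hwe : ⟪w, e⟫ = 0 := by rw [real_inner_comm, he_w]
  have hnum : gaussCurvature (h · ·) (r • e) (a • e + c • w) =
      r ^ 2 * c ^ 2 * gaussCurvature (h · ·) e w := by
    simp only [gaussCurvature, ← real_inner_self_eq_norm_sq, map_add, map_smul,
      LinearMap.add_apply, LinearMap.smul_apply, inner_add_left, inner_add_right,
      inner_smul_left, inner_smul_right, hs w e, real_inner_comm (h e e) (h e w)]
    simp
    ring
  have hden : ⟪r • e, r • e⟫ * ⟪a • e + c • w, a • e + c • w⟫ - ⟪r • e, a • e + c • w⟫ ^ 2 =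
      r ^ 2 * c ^ 2 := by
    simp only [inner_add_left, inner_add_right, inner_smul_left, inner_smul_right, hee, hww,
      he_w, hwe]
    simp
    ring
  rw [hnum, hden, mul_div_cancel_left₀ _ (by positivity)]
  exact abs_gaussCurvature_le_of_orthonormal b h hs hew

/-- The sum over ordered pairs is ‖tr h‖² minus the sum of squares. Diagonal terms vanish, and
symmetry counts each pair i < j twice. -/
theorem sum_gaussCurvature_of_trace_eq_zero {V : Type*} {n : ℕ} (b : Fin n → V)
    (h : V → V → E) (hs : ∀ u v, h u v = h v u) (htr : ∑ i, h (b i) (b i) = 0) :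
    ∑ i, ∑ j ∈ Finset.Ioi i, gaussCurvature h (b i) (b j) =
      -((∑ i, ∑ j, ‖h (b i) (b j)‖ ^ 2) / 2) := by
  have hsymm : ∀ u v, gaussCurvature h u v = gaussCurvature h v u := fun u v ↦ by
    rw [gaussCurvature, gaussCurvature, hs u v, real_inner_comm]
  have hself : ∀ u, gaussCurvature h u u = 0 := fun u ↦ by
    rw [gaussCurvature, real_inner_self_eq_norm_sq, sub_self]
  have htotal : ∑ i, ∑ j, gaussCurvature h (b i) (b j) =
      -∑ i, ∑ j, ‖h (b i) (b j)‖ ^ 2 := by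
    simp only [gaussCurvature, Finset.sum_sub_distrib, ← inner_sum, htr]
    simp
  have hsplit : ∀ i, ∑ j, gaussCurvature h (b i) (b j) =
      ∑ j ∈ Finset.Ioi i, gaussCurvature h (b i) (b j)
        + ∑ j ∈ Finset.Iio i, gaussCurvature h (b i) (b j) := fun i ↦ by
    rw [← Finset.sum_subset (Finset.subset_univ (Finset.Ioi i ∪ Finset.Iio i)),
      Finset.sum_union]
    · rw [Finset.disjoint_left]
      intro j hj hj'
      exact lt_asymm (Finset.mem_Ioi.1 hj) (Finset.mem_Iio.1 hj')
    · intro j _ hj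
      have : j = i := by
        simp only [Finset.mem_union, Finset.mem_Ioi, Finset.mem_Iio, not_or, not_lt] at hj
        exact le_antisymm hj.1 hj.2
      rw [this, hself]
  have hswap : ∑ i, ∑ j ∈ Finset.Iio i, gaussCurvature h (b i) (b j) =
      ∑ i, ∑ j ∈ Finset.Ioi i, gaussCurvature h (b i) (b j) := by
    rw [Finset.sum_comm' (t' := Finset.univ) (s' := fun j ↦ Finset.Ioi j) (by simp)]
    exact Finset.sum_congr rfl fun i _ ↦ Finset.sum_congr rfl fun j _ ↦ hsymm _ _
  simp only [hsplit, Finset.sum_add_distrib, hswap] at htotal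
  linarith

/-- A symmetric bilinear map, as an unbundled function. -/
structure IsSymmBilin (h : V → V → E) : Prop where
  add_left : ∀ u u' v, h (u + u') v = h u v + h u' v
  smul_left : ∀ (c : ℝ) u v, h (c • u) v = c • h u v
  symm : ∀ u v, h u v = h v u

theorem IsSymmBilin.exists_linearMap {h : V → V → E} (hh : IsSymmBilin h) :
    ∃ B : V →ₗ[ℝ] V →ₗ[ℝ] E, h = (B · ·) :=
  ⟨LinearMap.mk₂ ℝ h hh.add_left hh.smul_left
    (fun u v v' ↦ by rw [hh.symm, hh.add_left, hh.symm v, hh.symm v'])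
    (fun c u v ↦ by rw [hh.symm, hh.smul_left, hh.symm v]), rfl⟩

theorem IsSymmBilin.abs_gaussCurvature_div_le [FiniteDimensional ℝ E] {ι : Type*} [Fintype ι]
    {h : V → V → E} (hh : IsSymmBilin h) (b : OrthonormalBasis ι ℝ V) {u v : V}
    (huv : LinearIndependent ℝ ![u, v]) :
    |gaussCurvature h u v / (⟪u, u⟫ * ⟪v, v⟫ - ⟪u, v⟫ ^ 2)| ≤
      (∑ i, ∑ j, ‖h (b i) (b j)‖ ^ 2) / 2 := by
  obtain ⟨B, rfl⟩ := hh.exists_linearMap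
  exact MinimalImmersion.abs_gaussCurvature_div_le b B hh.symm huv

end LinearAlgebra

/-- Contracting curvature components satisfying the Gauss equation with vectors `a`, `b`. -/
theorem sum_contraction_eq_inner_sub_inner {ι E : Type*} [Fintype ι] [NormedAddCommGroup E]
    [InnerProductSpace ℝ E] {G : ι → ι → ℝ} {R : ι → ι → ι → ι → ℝ} {N : ι → ι → E}
    (hR : ∀ i j k p, ∑ l, G l p * R l i j k = ⟪N j k, N i p⟫ - ⟪N i k, N j p⟫) (a b : ι → ℝ) :
    ∑ i, ∑ j, ∑ k, ∑ l, ∑ p, G l p * R l i j k * a i * b j * b k * a p =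
      ⟪∑ j, ∑ k, (b j * b k) • N j k, ∑ i, ∑ p, (a i * a p) • N i p⟫
        - ⟪∑ i, ∑ k, (a i * b k) • N i k, ∑ j, ∑ p, (b j * a p) • N j p⟫ := by
  -- The index `l` occurs only in `G` and `R`, so the Gauss equation absorbs its sum.
  have hsum : ∀ i j k, ∑ l, ∑ p, G l p * R l i j k * a i * b j * b k * a p =
      ∑ p, a i * b j * b k * a p * (⟪N j k, N i p⟫ - ⟪N i k, N j p⟫) := fun i j k ↦ by
    rw [Finset.sum_comm]
    refine Finset.sum_congr rfl fun p _ ↦ ?_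
    rw [← hR, Finset.mul_sum]
    exact Finset.sum_congr rfl fun l _ ↦ by ring
  have h : ∀ c d c' d' : ι → ℝ,
      ⟪∑ i, ∑ j, (c i * d j) • N i j, ∑ k, ∑ p, (c' k * d' p) • N k p⟫ =
        ∑ i, ∑ j, ∑ k, ∑ p, c i * d j * (c' k * d' p) * ⟪N i j, N k p⟫ := fun c d c' d' ↦ by
    simp only [sum_inner, real_inner_smul_left]
    simp only [inner_sum, real_inner_smul_right, Finset.mul_sum, mul_assoc]
  rw [h, h]
  simp only [hsum, mul_sub, Finset.sum_sub_distrib]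
  congr 1
  · rw [Finset.sum_comm]
    refine Finset.sum_congr rfl fun j _ ↦ ?_
    rw [Finset.sum_comm]
    refine Finset.sum_congr rfl fun k _ ↦ Finset.sum_congr rfl fun i _ ↦
      Finset.sum_congr rfl fun p _ ↦ ?_
    ring
  · refine Finset.sum_congr rfl fun i _ ↦ ?_
    rw [Finset.sum_comm]
    refine Finset.sum_congr rfl fun k _ ↦ Finset.sum_congr rfl fun j _ ↦
      Finset.sum_congr rfl fun p _ ↦ ?_
    ring

/-! ### The immersion read in a chart -/

section ChartExpression

variable {n m : ℕ} {M : Type*} [TopologicalSpace M] [ChartedSpace (Model n) M]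
  [IsManifold (𝓡 n) ∞ M]

/-- The expression of `f` in the preferred chart around `x`. -/
def chartExpr (f : M → Model m) (x : M) : Model n → Model m :=
  f ∘ (extChartAt (𝓡 n) x).symm

omit [IsManifold (𝓡 n) ∞ M] in
theorem eventually_mem_target (x : M) {y : Model n} (hy : y ∈ (extChartAt (𝓡 n) x).target) :
    ∀ᶠ z in 𝓝 y, z ∈ (extChartAt (𝓡 n) x).target :=
  (isOpen_extChartAt_target x).eventually_mem hy

theorem contDiffAt_chartExpr {f : M → Model m} (hf : ContMDiff (𝓡 n) 𝓘(ℝ, Model m) ∞ f) (x : M)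
    {y : Model n} (hy : y ∈ (extChartAt (𝓡 n) x).target) :
    ContDiffAt ℝ ∞ (chartExpr f x) y := by
  have h : ContMDiffOn 𝓘(ℝ, Model n) 𝓘(ℝ, Model m) ∞ (chartExpr f x)
      (extChartAt (𝓡 n) x).target :=
    hf.comp_contMDiffOn (contMDiffOn_extChartAt_symm x)
  exact (contMDiffOn_iff_contDiffOn.1 h).contDiffAt (eventually_mem_target x hy)

theorem fderiv_chartExpr_apply {f : M → Model m} (hf : ContMDiff (𝓡 n) 𝓘(ℝ, Model m) ∞ f) (x : M)
    {y : Model n} (hy : y ∈ (extChartAt (𝓡 n) x).target) (w : Model n) :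
    fderiv ℝ (chartExpr f x) y w = differential n f ((extChartAt (𝓡 n) x).symm y)
      (mfderiv 𝓘(ℝ, Model n) (𝓡 n) (extChartAt (𝓡 n) x).symm y w) := by
  have h1 : MDifferentiableAt (𝓡 n) 𝓘(ℝ, Model m) f ((extChartAt (𝓡 n) x).symm y) :=
    hf.mdifferentiableAt (by simp)
  have h2 : MDifferentiableAt 𝓘(ℝ, Model n) (𝓡 n) (extChartAt (𝓡 n) x).symm y :=
    ((contMDiffOn_extChartAt_symm (n := ∞) x).contMDiffAt
      (eventually_mem_target x hy)).mdifferentiableAt (by simp)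
  rw [← mfderiv_eq_fderiv, chartExpr, mfderiv_comp y h1 h2]
  rfl

theorem differential_eq_fderiv_chartExpr {f : M → Model m}
    (hf : ContMDiff (𝓡 n) 𝓘(ℝ, Model m) ∞ f) (x : M) (u : TangentSpace (𝓡 n) x) :
    differential n f x u = fderiv ℝ (chartExpr f x) (extChartAt (𝓡 n) x x) (coord x u) := by
  have h1 : MDifferentiableAt 𝓘(ℝ, Model n) 𝓘(ℝ, Model m) (chartExpr f x)
      (extChartAt (𝓡 n) x x) :=
    ((contDiffAt_chartExpr hf x (mem_extChartAt_target x)).differentiableAt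
      (by simp)).mdifferentiableAt
  have h2 : MDifferentiableAt (𝓡 n) 𝓘(ℝ, Model n) (extChartAt (𝓡 n) x) x :=
    mdifferentiableAt_extChartAt (mem_chart_source _ x)
  have heq : f =ᶠ[𝓝 x] chartExpr f x ∘ extChartAt (𝓡 n) x := by
    filter_upwards [extChartAt_source_mem_nhds (I := 𝓡 n) x] with z hz
    rw [Function.comp_apply, chartExpr, Function.comp_apply, (extChartAt (𝓡 n) x).left_inv hz]
  have h3 : mfderiv (𝓡 n) 𝓘(ℝ, Model m) f x =
      (mfderiv 𝓘(ℝ, Model n) 𝓘(ℝ, Model m) (chartExpr f x) (extChartAt (𝓡 n) x x)).comp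
        (mfderiv (𝓡 n) 𝓘(ℝ, Model n) (extChartAt (𝓡 n) x) x) := by
    rw [← mfderiv_comp x h1 h2]
    exact heq.mfderiv_eq
  rw [mfderiv_eq_fderiv] at h3
  exact congrArg (fun L : Model n →L[ℝ] Model m ↦ L u) h3

omit [IsManifold (𝓡 n) ∞ M] in
theorem coord_add (x : M) (u v : TangentSpace (𝓡 n) x) :
    coord x (u + v) = coord x u + coord x v :=
  map_add (mfderiv (𝓡 n) 𝓘(ℝ, Model n) (extChartAt (𝓡 n) x) x) u v

omit [IsManifold (𝓡 n) ∞ M] in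
theorem coord_smul (x : M) (c : ℝ) (u : TangentSpace (𝓡 n) x) :
    coord x (c • u) = c • coord x u :=
  map_smul (mfderiv (𝓡 n) 𝓘(ℝ, Model n) (extChartAt (𝓡 n) x) x) c u

theorem coord_surjective (x : M) : Function.Surjective (coord (n := n) x) := by
  have : IsManifold (𝓡 n) 1 M := IsManifold.of_le (n := ∞) (by simp)
  exact (isInvertible_mfderiv_extChartAt (I := 𝓡 n) (mem_extChartAt_source x)).bijective.surjective

theorem mfderiv_extChartAt_symm_injective (x : M) {y : Model n}
    (hy : y ∈ (extChartAt (𝓡 n) x).target) :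
    Function.Injective (mfderiv 𝓘(ℝ, Model n) (𝓡 n) (extChartAt (𝓡 n) x).symm y) := by
  have : IsManifold (𝓡 n) 1 M := IsManifold.of_le (n := ∞) (by simp)
  have h := isInvertible_mfderivWithin_extChartAt_symm hy
  rw [ModelWithCorners.range_eq_univ, mfderivWithin_univ] at h
  exact h.bijective.injective

theorem eq_sum_smul_single (a : Model n) : a = ∑ i, a i • EuclideanSpace.single i (1 : ℝ) := by
  ext j
  simp [Finset.sum_apply, Pi.single_apply]

/-- Identifies the tangent space in the definition of h with the span in the coordinate Gauss
equation. -/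
theorem range_differential {f : M → Model m} (hf : ContMDiff (𝓡 n) 𝓘(ℝ, Model m) ∞ f) (x : M) :
    LinearMap.range (differential n f x).toLinearMap = Submodule.span ℝ
      (Set.range fun l ↦ vecPartial l (chartExpr f x) (extChartAt (𝓡 n) x x)) := by
  apply le_antisymm
  · rintro _ ⟨u, rfl⟩
    change differential n f x u ∈ _
    rw [differential_eq_fderiv_chartExpr hf, eq_sum_smul_single (coord x u), map_sum]
    refine Submodule.sum_mem _ fun l _ ↦ ?_
    rw [map_smul]
    exact Submodule.smul_mem _ _ (Submodule.subset_span (Set.mem_range_self l))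
  · rw [Submodule.span_le]
    rintro _ ⟨l, rfl⟩
    obtain ⟨u, hu⟩ := coord_surjective x (EuclideanSpace.single l (1 : ℝ))
    refine ⟨u, ?_⟩
    change differential n f x u = _
    rw [differential_eq_fderiv_chartExpr hf, hu]
    rfl

/-! ### Metric and curvature of M in terms of the immersion -/

variable [RiemannianBundle (fun x : M ↦ TangentSpace (𝓡 n) x)]

theorem gramMatrix_eq_inner {f : M → Model m} (hf : IsIsometricImmersion n f) (x : M) {y : Model n}
    (hy : y ∈ (extChartAt (𝓡 n) x).target) (i j : Fin n) :
    gramMatrix x y i j = ⟪vecPartial i (chartExpr f x) y, vecPartial j (chartExpr f x) y⟫ := by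
  rw [vecPartial, vecPartial, fderiv_chartExpr_apply hf.contMDiff x hy,
    fderiv_chartExpr_apply hf.contMDiff x hy, hf.inner_differential]
  rfl

/-- An isometric differential is injective, as is that of φ⁻¹, so the ∂ᵢF are independent and their
Gram matrix is positive definite. -/
theorem det_gramMatrix_ne_zero {f : M → Model m} (hf : IsIsometricImmersion n f) (x : M)
    {y : Model n} (hy : y ∈ (extChartAt (𝓡 n) x).target) : (gramMatrix x y).det ≠ 0 := by
  have hG : gramMatrix x y = Matrix.gram ℝ fun i ↦ vecPartial i (chartExpr f x) y := by
    ext i j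
    exact gramMatrix_eq_inner hf x hy i j
  have hinj : Function.Injective (fderiv ℝ (chartExpr f x) y) := by
    rw [injective_iff_map_eq_zero]
    intro w hw
    rw [fderiv_chartExpr_apply hf.contMDiff x hy] at hw
    have h0 := hf.inner_differential _
      (mfderiv 𝓘(ℝ, Model n) (𝓡 n) (extChartAt (𝓡 n) x).symm y w)
      (mfderiv 𝓘(ℝ, Model n) (𝓡 n) (extChartAt (𝓡 n) x).symm y w)
    rw [hw, inner_zero_left, eq_comm, inner_self_eq_zero] at h0
    exact mfderiv_extChartAt_symm_injective x hy (h0.trans (map_zero _).symm)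
  have hli : LinearIndependent ℝ fun i ↦ vecPartial i (chartExpr f x) y := by
    have h := (EuclideanSpace.basisFun (Fin n) ℝ).toBasis.linearIndependent.map'
      (fderiv ℝ (chartExpr f x) y).toLinearMap (LinearMap.ker_eq_bot.2 hinj)
    have heq : (fun i ↦ vecPartial i (chartExpr f x) y) =
        (fderiv ℝ (chartExpr f x) y).toLinearMap ∘
          (EuclideanSpace.basisFun (Fin n) ℝ).toBasis := by
      ext1 i
      simp [vecPartial]
    rw [heq]
    exact h
  rw [hG]
  exact (Matrix.posDef_gram_of_linearIndependent hli).det_pos.ne'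

/-- Each ∂ₖg_ab is a sum of two inner products. By symmetry of second derivatives, the Christoffel
combination collapses to 2⟪∂ᵢ∂ⱼF, ∂ₚF⟫. -/
theorem christoffel_eq_inducedChristoffel {f : M → Model m} (hf : IsIsometricImmersion n f) (x : M)
    {y : Model n} (hy : y ∈ (extChartAt (𝓡 n) x).target) (l i j : Fin n) :
    christoffel x l i j y = inducedChristoffel (chartExpr f x) (gramMatrix x) l i j y := by
  have hF := contDiffAt_chartExpr hf.contMDiff x hy
  have hD : ∀ p, DifferentiableAt ℝ (vecPartial p (chartExpr f x)) y := fun p ↦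
    (contDiffAt_vecPartial hF p).differentiableAt (by simp)
  have hG : ∀ k a b, partialDeriv k (fun z ↦ gramMatrix x z a b) y =
      ⟪vecPartial k (vecPartial a (chartExpr f x)) y, vecPartial b (chartExpr f x) y⟫
      + ⟪vecPartial a (chartExpr f x) y, vecPartial k (vecPartial b (chartExpr f x)) y⟫ :=
    fun k a b ↦ by
      rw [← partialDeriv_inner (hD a) (hD b)]
      exact partialDeriv_congr ((eventually_mem_target x hy).mono fun z hz ↦
        gramMatrix_eq_inner hf x hz a b) k
  rw [christoffel, inducedChristoffel, Finset.mul_sum]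
  refine Finset.sum_congr rfl fun p _ ↦ ?_
  rw [hG, hG, hG, vecPartial_comm hF j i, vecPartial_comm hF p i, vecPartial_comm hF p j,
    real_inner_comm _ (vecPartial i (chartExpr f x) y),
    real_inner_comm _ (vecPartial i (vecPartial p (chartExpr f x)) y)]
  ring

/-- The **Gauss equation** for the curvature components in the preferred chart. -/
theorem sum_gramMatrix_mul_curvatureComponent {f : M → Model m} (hf : IsIsometricImmersion n f)
    (x : M) {K : Submodule ℝ (Model m)} (hK : K = LinearMap.range (differential n f x).toLinearMap)
    (i j k p : Fin n) :
    ∑ l, gramMatrix x (extChartAt (𝓡 n) x x) l p *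
        curvatureComponent x l i j k (extChartAt (𝓡 n) x x) =
      ⟪Kᗮ.starProjection (vecPartial j (vecPartial k (chartExpr f x)) (extChartAt (𝓡 n) x x)),
        Kᗮ.starProjection (vecPartial i (vecPartial p (chartExpr f x)) (extChartAt (𝓡 n) x x))⟫
      - ⟪Kᗮ.starProjection (vecPartial i (vecPartial k (chartExpr f x)) (extChartAt (𝓡 n) x x)),
        Kᗮ.starProjection
          (vecPartial j (vecPartial p (chartExpr f x)) (extChartAt (𝓡 n) x x))⟫ := by
  have hy := mem_extChartAt_target (I := 𝓡 n) x
  have hS := eventually_mem_target x hy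
  -- Equality near the point is needed, since the curvature differentiates the symbols.
  have hC : ∀ l i j, christoffel x l i j =ᶠ[𝓝 (extChartAt (𝓡 n) x x)]
      inducedChristoffel (chartExpr f x) (gramMatrix x) l i j := fun l i j ↦
    hS.mono fun z hz ↦ christoffel_eq_inducedChristoffel hf x hz l i j
  rw [range_differential hf.contMDiff] at hK
  rw [← gauss_equation_inducedChristoffel (contDiffAt_chartExpr hf.contMDiff x hy)
    (hS.mono fun z hz ↦ gramMatrix_eq_inner hf x hz)
    (hS.mono fun z hz ↦ det_gramMatrix_ne_zero hf x hz) hK]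
  simp only [curvatureComponent, partialDeriv_congr (hC _ _ _), (hC _ _ _).self_of_nhds]

omit [RiemannianBundle (fun x : M ↦ TangentSpace (𝓡 n) x)] in
theorem secondFundamentalForm_comm {f : M → Model m} (hf : ContMDiff (𝓡 n) 𝓘(ℝ, Model m) ∞ f)
    (x : M) (u v : TangentSpace (𝓡 n) x) :
    secondFundamentalForm n f x u v = secondFundamentalForm n f x v u := by
  rw [secondFundamentalForm, secondFundamentalForm]
  congr 1
  refine (contDiffAt_chartExpr hf x (mem_extChartAt_target x)).isSymmSndFDerivAt ?_ _ _
  rw [minSmoothness_of_isRCLikeNormedField]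
  exact WithTop.coe_le_coe.2 le_top

omit [RiemannianBundle (fun x : M ↦ TangentSpace (𝓡 n) x)] in
theorem secondFundamentalForm_eq_sum {f : M → Model m} (hf : ContMDiff (𝓡 n) 𝓘(ℝ, Model m) ∞ f)
    (x : M) (u v : TangentSpace (𝓡 n) x) :
    secondFundamentalForm n f x u v = ∑ i, ∑ j, (coord x u i * coord x v j) •
      (LinearMap.range (differential n f x).toLinearMap)ᗮ.starProjection
        (vecPartial i (vecPartial j (chartExpr f x)) (extChartAt (𝓡 n) x x)) := by
  simp only [vecPartial_vecPartial (contDiffAt_chartExpr hf x (mem_extChartAt_target x))]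
  rw [secondFundamentalForm]
  conv_lhs => rw [eq_sum_smul_single (coord x u), eq_sum_smul_single (coord x v)]
  simp only [map_sum, map_smul, sum_apply, smul_apply,
    Finset.smul_sum, smul_smul]
  rw [Finset.sum_comm]
  refine Finset.sum_congr rfl fun i _ ↦ Finset.sum_congr rfl fun j _ ↦ ?_
  rw [mul_comm]
  rfl

theorem riemannTensor_eq_gaussCurvature {f : M → Model m} (hf : IsIsometricImmersion n f) (x : M)
    (u v : TangentSpace (𝓡 n) x) :
    riemannTensor x u v u v = gaussCurvature (secondFundamentalForm n f x) u v := by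
  -- The arguments are ordered as the contraction lemma produces them.
  have hgauss : gaussCurvature (secondFundamentalForm n f x) u v =
      ⟪secondFundamentalForm n f x v v, secondFundamentalForm n f x u u⟫
        - ⟪secondFundamentalForm n f x u v, secondFundamentalForm n f x v u⟫ := by
    rw [secondFundamentalForm_comm hf.contMDiff x v u, real_inner_comm,
      real_inner_self_eq_norm_sq]
    rfl
  rw [hgauss]
  simp only [secondFundamentalForm_eq_sum hf.contMDiff]
  exact sum_contraction_eq_inner_sub_inner (sum_gramMatrix_mul_curvatureComponent hf x rfl) _ _

theorem isSymmBilin_secondFundamentalForm {f : M → Model m}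
    (hf : ContMDiff (𝓡 n) 𝓘(ℝ, Model m) ∞ f) (x : M) :
    IsSymmBilin (secondFundamentalForm n f x) where
  add_left u u' v := by
    have h : coord x (u + u') = coord x u + coord x u' := coord_add x u u'
    simp only [secondFundamentalForm, h, map_add, add_apply]
  smul_left c u v := by
    have h : coord x (c • u) = c • coord x u := coord_smul x c u
    simp only [secondFundamentalForm, h, map_smul, smul_apply]
  symm := secondFundamentalForm_comm hf x

theorem scalarCurvature_eq_neg_half_sum {f : M → Model m} (hf : IsMinimalIsometricImmersion n f)
    (hn : n ≠ 0) (x : M) :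
    scalarCurvature n x = -((∑ i, ∑ j,
      ‖secondFundamentalForm n f x (frame x i) (frame x j)‖ ^ 2) / 2) := by
  -- H is n⁻¹ times the trace, so n ≠ 0 is what makes the trace vanish with H.
  have htr : ∑ i, secondFundamentalForm n f x (frame x i) (frame x i) = 0 :=
    (smul_eq_zero.1 (hf.meanCurvature_eq_zero x)).resolve_left
      (inv_ne_zero (Nat.cast_ne_zero.2 hn))
  rw [← sum_gaussCurvature_of_trace_eq_zero (frame x) _
    (secondFundamentalForm_comm hf.contMDiff x) htr, scalarCurvature]
  simp only [riemannTensor_eq_gaussCurvature hf.toIsIsometricImmersion]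

theorem abs_sectionalCurvature_le {f : M → Model m} (hf : IsIsometricImmersion n f) (x : M)
    {u v : TangentSpace (𝓡 n) x} (huv : LinearIndependent ℝ ![u, v]) :
    |sectionalCurvature x u v| ≤ (∑ i, ∑ j,
      ‖secondFundamentalForm n f x (frame x i) (frame x j)‖ ^ 2) / 2 := by
  rw [sectionalCurvature, riemannTensor_eq_gaussCurvature hf]
  exact (isSymmBilin_secondFundamentalForm hf.contMDiff x).abs_gaussCurvature_div_le (frame x) huv

end ChartExpression

end

end MinimalImmersion

theorem corollary3p2 {n : ℕ} (hn : 3 ≤ n)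
    {M : Type*} [TopologicalSpace M] [ChartedSpace (EuclideanSpace ℝ (Fin n)) M]
    [IsManifold (𝓡 n) ∞ M]
    [RiemannianBundle (fun x : M ↦ TangentSpace (𝓡 n) x)]
    [IsContMDiffRiemannianBundle (𝓡 n) ∞ (EuclideanSpace ℝ (Fin n))
      (fun x : M ↦ TangentSpace (𝓡 n) x)]
    (hM : ∃ (m : ℕ) (f : M → EuclideanSpace ℝ (Fin m)),
      MinimalImmersion.IsMinimalIsometricImmersion n f)
    (x : M) (u v : TangentSpace (𝓡 n) x) (huv : LinearIndependent ℝ ![u, v]) :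
    MinimalImmersion.scalarCurvature n x ≤ MinimalImmersion.sectionalCurvature x u v ∧
      MinimalImmersion.sectionalCurvature x u v ≤ -MinimalImmersion.scalarCurvature n x := by
  obtain ⟨m, f, hf⟩ := hM
  -- Once τ = -S/2, the two inequalities together say |k| ≤ S/2.
  rw [MinimalImmersion.scalarCurvature_eq_neg_half_sum hf (by omega) x, neg_neg]
  exact abs_le.1 (MinimalImmersion.abs_sectionalCurvature_le hf.toIsIsometricImmersion x huv)
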